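/- Let $V$ be a set of variables and $C$ a set of constants. Terms are built from variables, constants and a further constant $0$ (the unity element) with the standard operators: sequences $[t_1,\ldots,t_n]$, asymmetric encryption $\mathrm{penc}(t,k)$, symmetric encryption $\mathrm{senc}(t,k)$, keys $\mathrm{pk}(t)$ and $\mathrm{sh}(t_1,t_2)$, and with the operator $t_1\oplus\cdots\oplus t_n$, which takes any number $n\ge 2$ of arguments. A term of the last form is called an $\oplus$-term, and $t_1,\ldots,t_n$ are its interms. $\mathrm{SubTerms}(T)$ is the set of all subterms of elements of $T$ (every term is a subterm of itself). For a set $E$ of equations between terms, $=_E$ denotes the least congruence on terms that contains all substitution instances of the equations; $m$ and $t$ are $E$-unifiable if $m\sigma =_E t\sigma$ for some substitution $\sigma$. $\mathsf{Std}$ consists of the trivial equations $u=u$ for all terms $u$ headed by a standard operator (so these operators are free), $\mathsf{Free}_\oplus$ consists of the trivial equations $u=u$ for all $\oplus$-terms $u$, and $\mathsf{ACUN}$ consists of $$t_1\oplus(t_2\oplus t_3)=(t_1\oplus t_2)\oplus t_3,\quad t_1\oplus t_2=t_2\oplus t_1,\quad t\oplus 0=t,\quad t\oplus t=0$$ together with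 the equations identifying $t_1\oplus t_2\oplus\cdots\oplus t_n$ with $t_1\oplus(t_2\oplus\cdots\oplus t_n)$ for $n\ge 3$. A set $T$ of terms is DNUT-satisfying if 1. for every $\oplus$-term $t_1\oplus\cdots\oplus t_n\in\mathrm{SubTerms}(T)$ and all $i\ne j$, the terms $t_i$ and $t_j$ are not $\mathsf{Std}$-unifiable; 2. for any two different $\oplus$-terms $t,t'\in\mathrm{SubTerms}(T)$, no interm of $t$ is $\mathsf{Std}$-unifiable with an interm of $t'$; 3. no $\oplus$-term in $\mathrm{SubTerms}(T)$ has $0$ as an interm. **Theorem 1.** Let $T$ be a DNUT-satisfying set of terms such that no $\oplus$-term in $\mathrm{SubTerms}(T)$ has a variable as an interm. Then any two terms $m,t\in T$ that are not variables and are unifiable modulo $\mathsf{Std}\cup\mathsf{ACUN}$ are also unifiable modulo $\mathsf{Std}\cup\mathsf{Free}_\oplus$. -/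

import Mathlib

namespace TagUnif

/-- The operators of the standard signature; `seq n` builds sequences `[t₁, …, tₙ]`, `penc` and
`senc` are asymmetric and symmetric encryption (message, key), `pk` and `sh` build public and
shared keys. -/
inductive StdOp : Type
  | seq (n : ℕ)
  | penc
  | senc
  | pk
  | sh

/-- The number of arguments of a standard operator. -/
def StdOp.arity : StdOp → ℕ
  | .seq n => n
  | .penc => 2
  | .senc => 2
  | .pk => 1
  | .sh => 2

/-- Terms over the variables `V` and the constants `C`. The unity element `0` is a further
constant, and `oplus n ![t₁, …]` is the `⊕`-term `t₁ ⊕ ⋯ ⊕ tₙ₊₂`; the operator `⊕` takes any number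
of arguments which is at least two. -/
inductive Term (V : Type*) (C : Type*) : Type _
  | var (x : V)
  | const (c : C)
  | zero
  | std (f : StdOp) (args : Fin f.arity → Term V C)
  | oplus (n : ℕ) (args : Fin (n + 2) → Term V C)

variable {V : Type*} {C : Type*}

/-- Application of the substitution `σ` to a term. -/
def Term.subst (σ : V → Term V C) : Term V C → Term V C
  | .var x => σ x
  | .const c => .const c
  | .zero => .zero
  | .std f args => .std f fun i => (args i).subst σ
  | .oplus n args => .oplus n fun i => (args i).subst σ

/-- The binary case of `⊕`. -/
def Term.add (s t : Term V C) : Term V C := .oplus 0 ![s, t]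

/-- `Subterm s t`: the term `s` is `t` or a subterm of an argument of `t`. -/
inductive Subterm : Term V C → Term V C → Prop
  | refl (t : Term V C) : Subterm t t
  | std (s : Term V C) (f : StdOp) (args : Fin f.arity → Term V C) (i : Fin f.arity) :
      Subterm s (args i) → Subterm s (.std f args)
  | oplus (s : Term V C) (n : ℕ) (args : Fin (n + 2) → Term V C) (i : Fin (n + 2)) :
      Subterm s (args i) → Subterm s (.oplus n args)

/-- The set of all subterms of elements of `T`. -/
def SubTerms (T : Set (Term V C)) : Set (Term V C) := {s | ∃ t ∈ T, Subterm s t}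

/-- `Interm s t`: the term `t` is an `⊕`-term, and `s` is one of its arguments. -/
def Interm (s t : Term V C) : Prop :=
  ∃ (n : ℕ) (args : Fin (n + 2) → Term V C) (i : Fin (n + 2)), t = .oplus n args ∧ args i = s

/-- A theory is a set of equations, that is, of pairs of terms. -/
abbrev Theory (V : Type*) (C : Type*) := Set (Term V C × Term V C)

/-- Equality modulo a theory: the least congruence on terms that contains all
substitution instances of the equations. -/
inductive EqMod (Th : Theory V C) : Term V C → Term V C → Prop
  | eqn (l r : Term V C) (σ : V → Term V C) : (l, r) ∈ Th → EqMod Th (l.subst σ) (r.subst σ)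
  | refl (t : Term V C) : EqMod Th t t
  | symm (s t : Term V C) : EqMod Th s t → EqMod Th t s
  | trans (s t u : Term V C) : EqMod Th s t → EqMod Th t u → EqMod Th s u
  | std (f : StdOp) (a b : Fin f.arity → Term V C) :
      (∀ i, EqMod Th (a i) (b i)) → EqMod Th (.std f a) (.std f b)
  | oplus (n : ℕ) (a b : Fin (n + 2) → Term V C) :
      (∀ i, EqMod Th (a i) (b i)) → EqMod Th (.oplus n a) (.oplus n b)

/-- The theory of the standard operators, which are free. -/
def stdTheory (V : Type*) (C : Type*) : Theory V C :=
  {e | ∃ (f : StdOp) (args : Fin f.arity → Term V C), e = (.std f args, .std f args)}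

/-- The theory in which `⊕` is free. -/
def freeTheory (V : Type*) (C : Type*) : Theory V C :=
  {e | ∃ (n : ℕ) (args : Fin (n + 2) → Term V C), e = (.oplus n args, .oplus n args)}

/-- The ACUN theory of `⊕` and `0`: associativity, commutativity, unity, nilpotence. The equations
`iterate` say that `t₁ ⊕ t₂ ⊕ ⋯ ⊕ tₙ` is the iterated binary sum `t₁ ⊕ (t₂ ⊕ ⋯ ⊕ tₙ)`. -/
inductive AcunEqn : Term V C → Term V C → Prop
  | assoc (t₁ t₂ t₃ : Term V C) : AcunEqn (t₁.add (t₂.add t₃)) ((t₁.add t₂).add t₃)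
  | comm (t₁ t₂ : Term V C) : AcunEqn (t₁.add t₂) (t₂.add t₁)
  | unit (t : Term V C) : AcunEqn (t.add .zero) t
  | nil (t : Term V C) : AcunEqn (t.add t) .zero
  | iterate (n : ℕ) (args : Fin (n + 3) → Term V C) :
      AcunEqn (.oplus (n + 1) args) ((args 0).add (.oplus n fun i => args i.succ))

/-- The ACUN theory as a set of equations. -/
def acun (V : Type*) (C : Type*) : Theory V C := {e | AcunEqn e.1 e.2}

/-- `σ` unifies all the problems in `Γ` modulo `Th`. -/
def IsUnifier (Th : Theory V C) (σ : V → Term V C) (Γ : Set (Term V C × Term V C)) : Prop :=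
  ∀ p ∈ Γ, EqMod Th (p.1.subst σ) (p.2.subst σ)

/-- Two terms are unifiable modulo `Th`. -/
def Unifiable (Th : Theory V C) (m t : Term V C) : Prop :=
  ∃ σ : V → Term V C, IsUnifier Th σ {(m, t)}

/-- The tagging conditions on a set of terms. -/
structure DnutSatisfying (T : Set (Term V C)) : Prop where
  /-- No two interms (at different positions) of an `⊕`-term are unifiable modulo `stdTheory`. -/
  within : ∀ (n : ℕ) (args : Fin (n + 2) → Term V C), .oplus n args ∈ SubTerms T →
    ∀ i j, i ≠ j → ¬ Unifiable (stdTheory V C) (args i) (args j)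
  /-- Interms of different `⊕`-terms are not unifiable modulo `stdTheory`. -/
  between : ∀ t ∈ SubTerms T, ∀ t' ∈ SubTerms T, t ≠ t' →
    ∀ s s', Interm s t → Interm s' t' → ¬ Unifiable (stdTheory V C) s s'
  /-- The unity element is not an interm. -/
  unity : ∀ t ∈ SubTerms T, ¬ Interm .zero t

end TagUnif

/-! Under an assignment, every term has a value in a free Boolean group. Its generators, the atoms,
are the constants and the standard operators applied to encoded values. Terms equal modulo ACUN have
equal values (`EqMod.eval_eq`), so a unifier yields an assignment at which `m` and `t` agree.
Suppose that the value of a non-variable subterm determines its head and the values of its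
arguments, and that these are smaller. Then each value can be rebuilt into one term, which gives a
substitution making terms of equal value syntactically equal (`exists_subst_eq_of_value`).

The obstacle is cancellation in sums. If interms of equal value are unifiable, tagging makes them
identical. The relation "is an interm of" is a forest, and its leaves carry distinct single atoms.
Hence nothing cancels, values grow strictly along the forest, and they tell `⊕`-terms apart
(`oplus_eq_of_eval_eq`). Unifiability of interms of equal value comes in turn from the rebuilt
substitution. Induction on size breaks the circle (`intermsReflect`), since interms are smaller than
their `⊕`-term. -/

namespace TagUnif

open Relation

/-! ### Sizes and subterms. -/

section Size

variable {V : Type*} {C : Type*}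

/-- The number of nodes of a term. -/
def Term.size : Term V C → ℕ
  | .var _ => 1
  | .const _ => 1
  | .zero => 1
  | .std _ args => (∑ i, (args i).size) + 1
  | .oplus _ args => (∑ i, (args i).size) + 1

theorem Term.size_pos (t : Term V C) : 0 < t.size := by
  cases t <;> simp [Term.size]

theorem Term.size_lt_std (f : StdOp) (args : Fin f.arity → Term V C) (i : Fin f.arity) :
    (args i).size < (Term.std f args).size :=
  Nat.lt_succ_of_le
    (Finset.single_le_sum (f := fun i => (args i).size) (fun _ _ => Nat.zero_le _)
      (Finset.mem_univ i))

theorem Term.size_lt_oplus (n : ℕ) (args : Fin (n + 2) → Term V C) (i : Fin (n + 2)) :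
    (args i).size < (Term.oplus n args).size :=
  Nat.lt_succ_of_le
    (Finset.single_le_sum (f := fun i => (args i).size) (fun _ _ => Nat.zero_le _)
      (Finset.mem_univ i))

theorem Interm.size_lt {s t : Term V C} (h : Interm s t) : s.size < t.size := by
  obtain ⟨n, args, i, rfl, rfl⟩ := h
  exact Term.size_lt_oplus n args i

theorem Subterm.trans {s t u : Term V C} (h : Subterm s t) (h' : Subterm t u) : Subterm s u := by
  induction h' with
  | refl => exact h
  | std f args i _ ih => exact .std _ _ _ _ ih
  | oplus n args i _ ih => exact .oplus _ _ _ _ ih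

theorem SubTerms.of_subterm {T : Set (Term V C)} {s t : Term V C} (h : Subterm s t)
    (ht : t ∈ SubTerms T) : s ∈ SubTerms T := by
  obtain ⟨u, hu, htu⟩ := ht
  exact ⟨u, hu, h.trans htu⟩

theorem SubTerms.std_arg {T : Set (Term V C)} {f : StdOp} {args : Fin f.arity → Term V C}
    (h : Term.std f args ∈ SubTerms T) (i : Fin f.arity) : args i ∈ SubTerms T :=
  SubTerms.of_subterm (.std _ _ _ i (.refl _)) h

theorem SubTerms.oplus_arg {T : Set (Term V C)} {n : ℕ} {args : Fin (n + 2) → Term V C}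
    (h : Term.oplus n args ∈ SubTerms T) (i : Fin (n + 2)) : args i ∈ SubTerms T :=
  SubTerms.of_subterm (.oplus _ _ _ i (.refl _)) h

theorem unifiable_of_subst_eq (Th : Theory V C) {s t : Term V C} {τ : V → Term V C}
    (h : s.subst τ = t.subst τ) : Unifiable Th s t := by
  refine ⟨τ, ?_⟩
  rintro p rfl
  change EqMod Th (s.subst τ) (t.subst τ)
  rw [h]
  exact .refl _

end Size

/-! ### A model of ACUN: values in a free Boolean group. -/

section Model

variable {V : Type*} {C : Type*}

/-- The sequence of the entries of a list of terms. -/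
def Term.ofList (l : List (Term V C)) : Term V C := .std (.seq l.length) l.get

/-- The entries of a sequence. -/
def Term.entries : Term V C → List (Term V C)
  | .std (.seq _) args => List.ofFn args
  | _ => []

theorem Term.entries_ofList (l : List (Term V C)) : (Term.ofList l).entries = l :=
  List.ofFn_get l

theorem Term.size_ofList (l : List (Term V C)) :
    (Term.ofList l).size = (l.map Term.size).sum + 1 := by
  change (∑ i : Fin l.length, (l.get i).size) + 1 = _
  congr 1
  conv_rhs => rw [← List.ofFn_get l, List.map_ofFn, List.sum_ofFn]
  rfl

/-- The values of terms modulo ACUN: the free Boolean group on a set of atoms, for which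
terms themselves serve. -/
abbrev Value (V : Type*) (C : Type*) := Term V C →₀ ZMod 2

/-- A term that encodes a value, as the sequence of its atoms in some order. -/
noncomputable def Value.code (w : Value V C) : Term V C := .ofList w.support.toList

theorem Value.eq_of_support_eq {w w' : Value V C} (h : w.support = w'.support) : w = w' := by
  have key : ∀ x y : ZMod 2, (x ≠ 0 ↔ y ≠ 0) → x = y := by decide
  ext a
  refine key _ _ ?_
  rw [← Finsupp.mem_support_iff, ← Finsupp.mem_support_iff, h]

/-- Ensures that the atom of a standard term determines the values of its arguments. -/
theorem Value.code_injective : Function.Injective (Value.code : Value V C → Term V C) := by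
  intro w w' h
  have h' := congrArg Term.entries h
  simp only [Value.code, Term.entries_ofList] at h'
  apply Value.eq_of_support_eq
  ext a
  rw [← Finset.mem_toList, h', Finset.mem_toList]

theorem Value.size_code (w : Value V C) : w.code.size = (∑ a ∈ w.support, a.size) + 1 := by
  rw [Value.code, Term.size_ofList, Finset.sum_map_toList]

theorem Value.size_code_lt {w w' : Value V C} (h : w.support ⊂ w'.support) :
    w.code.size < w'.code.size := by
  rw [Value.size_code, Value.size_code]
  obtain ⟨a, ha, ha'⟩ := Finset.exists_of_ssubset h
  exact Nat.add_lt_add_right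
    (Finset.sum_lt_sum_of_subset h.subset ha ha' a.size_pos fun _ _ _ => Nat.zero_le _) 1

/-- The value of a term under an assignment of values to the variables. -/
noncomputable def Term.eval (ρ : V → Value V C) : Term V C → Value V C
  | .var x => ρ x
  | .const c => Finsupp.single (.const c) 1
  | .zero => 0
  | .std f args => Finsupp.single (.std f fun i => ((args i).eval ρ).code) 1
  | .oplus _ args => ∑ i, (args i).eval ρ

theorem Term.eval_subst (ρ : V → Value V C) (σ : V → Term V C) (t : Term V C) :
    (t.subst σ).eval ρ = t.eval fun x => (σ x).eval ρ := by
  induction t with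
  | var => rfl
  | const => rfl
  | zero => rfl
  | std f args ih => simp [Term.subst, Term.eval, ih]
  | oplus n args ih => simp [Term.subst, Term.eval, ih]

theorem Term.mem_support_eval_oplus {ρ : V → Value V C} {n : ℕ} {args : Fin (n + 2) → Term V C}
    {a : Term V C} (h : a ∈ ((Term.oplus n args).eval ρ).support) :
    ∃ i, a ∈ ((args i).eval ρ).support := by
  rw [Finsupp.mem_support_iff, Term.eval, Finsupp.finsetSum_apply] at h
  obtain ⟨i, -, hi⟩ := Finset.exists_ne_zero_of_sum_ne_zero h
  exact ⟨i, Finsupp.mem_support_iff.2 hi⟩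

theorem Term.eval_add (ρ : V → Value V C) (s t : Term V C) :
    (s.add t).eval ρ = s.eval ρ + t.eval ρ := by
  simp [Term.add, Term.eval, Fin.sum_univ_two]

theorem Value.add_self (w : Value V C) : w + w = 0 := by
  ext a
  exact CharTwo.add_self_eq_zero (w a)

theorem AcunEqn.eval_eq {l r : Term V C} (h : AcunEqn l r) (ρ : V → Value V C) :
    l.eval ρ = r.eval ρ := by
  cases h with
  | assoc => simp only [Term.eval_add, add_assoc]
  | comm => simp only [Term.eval_add, add_comm]
  | unit => simp [Term.eval_add, Term.eval]
  | nil => simp [Term.eval_add, Term.eval, Value.add_self]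
  | iterate n args => simp only [Term.eval_add, Term.eval, Fin.sum_univ_succ (n := n + 2)]

theorem EqMod.eval_eq {s t : Term V C} (h : EqMod (stdTheory V C ∪ acun V C) s t)
    (ρ : V → Value V C) : s.eval ρ = t.eval ρ := by
  induction h with
  | eqn l r σ h =>
    rw [Term.eval_subst, Term.eval_subst]
    rcases h with ⟨f, args, h⟩ | h
    · rw [(Prod.mk.inj h).1, (Prod.mk.inj h).2]
    · exact AcunEqn.eval_eq h _
  | refl => rfl
  | symm _ _ _ ih => exact ih.symm
  | trans _ _ _ _ _ ih ih' => exact ih.trans ih'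
  | std f a b _ ih => simp only [Term.eval, ih]
  | oplus n a b _ ih => simp only [Term.eval, ih]

end Model

/-! ### Syntactic unifiers rebuilt from values. -/

section FreeUnification

variable {V : Type*} {C : Type*}

/-- Replaces the arguments of the head operator. -/
def Term.mapArgs (g : Term V C → Term V C) : Term V C → Term V C
  | .var x => .var x
  | .const c => .const c
  | .zero => .zero
  | .std f args => .std f fun i => g (args i)
  | .oplus n args => .oplus n fun i => g (args i)

/-- The substitution `τ` replaces each variable by a term rebuilt from its value. -/
theorem exists_subst_eq_of_value {W : Type*} (S : Set (Term V C)) (v : Term V C → W) (sz : W → ℕ)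
    (hstd : ∀ f args, Term.std f args ∈ S → ∀ i, args i ∈ S ∧
      sz (v (args i)) < sz (v (.std f args)))
    (hoplus : ∀ n args, Term.oplus n args ∈ S → ∀ i, args i ∈ S ∧
      sz (v (args i)) < sz (v (.oplus n args)))
    -- Equal heads and equal argument values suffice for this; `mapArgs` avoids comparing argument
    -- tuples of different types.
    (hv : ∀ s ∈ S, ∀ t ∈ S, (∀ x, s ≠ .var x) → (∀ x, t ≠ .var x) → v s = v t →
      ∀ g : W → Term V C, s.mapArgs (fun a => g (v a)) = t.mapArgs fun a => g (v a)) :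
    ∃ τ : V → Term V C, ∀ s ∈ S, ∀ t ∈ S, v s = v t → s.subst τ = t.subst τ := by
  classical
  let Rep (w : W) (s : Term V C) : Prop := s ∈ S ∧ (∀ x, s ≠ .var x) ∧ v s = w
  -- The inner default is never reached, as arguments have smaller values. The outer one serves
  -- values carried in `S` at most by variables, where any fixed term would do.
  let step (w : W) (ih : ∀ u, sz u < sz w → Term V C) : Term V C :=
    if h : ∃ s, Rep w s then
      h.choose.mapArgs fun a => if ha : sz (v a) < sz w then ih (v a) ha else .zero
    else .zero
  let R : W → Term V C := (measure sz).wf.fix step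
  have hmap : ∀ s ∈ S, s.mapArgs (fun a => if sz (v a) < sz (v s) then R (v a) else .zero) =
      s.mapArgs fun a => R (v a) := by
    intro s hs
    cases s with
    | var | const | zero => rfl
    | std f args => simp only [Term.mapArgs, (hstd f args hs _).2, if_true]
    | oplus n args => simp only [Term.mapArgs, (hoplus n args hs _).2, if_true]
  have hR : ∀ s ∈ S, (∀ x, s ≠ .var x) → R (v s) = s.mapArgs fun a => R (v a) := by
    intro s hs hx
    have hex : ∃ t, Rep (v s) t := ⟨s, hs, hx, rfl⟩
    obtain ⟨h1, h2, h3⟩ := hex.choose_spec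
    have e : R (v s) =
        hex.choose.mapArgs fun a => if sz (v a) < sz (v s) then R (v a) else .zero := by
      have := (measure sz).wf.fix_eq step (v s)
      refine this.trans ?_
      simp only [step, dif_pos hex]
      rfl
    rw [e]
    have e' := hmap _ h1
    rw [h3] at e'
    rw [e']
    -- The rebuilt term does not depend on the chosen representative.
    exact hv _ h1 _ hs h2 hx h3 R
  have key : ∀ s ∈ S, s.subst (fun x => R (v (.var x))) = R (v s) := by
    intro s
    induction s with
    | var => intro _; rfl
    | const => intro hs; rw [hR _ hs (by simp)]; rfl
    | zero => intro hs; rw [hR _ hs (by simp)]; rfl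
    | std f args ih =>
      intro hs
      rw [hR _ hs (by simp)]
      simp only [Term.subst, Term.mapArgs, ih _ (hstd f args hs _).1]
    | oplus n args ih =>
      intro hs
      rw [hR _ hs (by simp)]
      simp only [Term.subst, Term.mapArgs, ih _ (hoplus n args hs _).1]
  exact ⟨_, fun s hs t ht h => by rw [key s hs, key t ht, h]⟩

end FreeUnification

/-! ### The forest of interms and the absence of cancellation. -/

section Tagging

variable {V : Type*} {C : Type*}

/-- `IntermIn T N a P`: the term `a` is an interm of `P`, a subterm of `T` of size at most `N`. -/
def IntermIn (T : Set (Term V C)) (N : ℕ) (a P : Term V C) : Prop :=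
  Interm a P ∧ P ∈ SubTerms T ∧ P.size ≤ N

/-- Interms of equal values, in `⊕`-terms of size at most `N`, are unifiable. -/
def IntermsReflect (T : Set (Term V C)) (N : ℕ) (ρ : V → Value V C) : Prop :=
  ∀ a P a' P', IntermIn T N a P → IntermIn T N a' P' → a.eval ρ = a'.eval ρ →
    Unifiable (stdTheory V C) a a'

variable {T : Set (Term V C)} {N : ℕ} {ρ : V → Value V C}

theorem IntermIn.arg {n : ℕ} {args : Fin (n + 2) → Term V C}
    (h : Term.oplus n args ∈ SubTerms T) (hN : (Term.oplus n args).size ≤ N) (i : Fin (n + 2)) :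
    IntermIn T N (args i) (.oplus n args) :=
  ⟨⟨n, args, i, rfl, rfl⟩, h, hN⟩

theorem IntermIn.size_le_of_reflTransGen {s t : Term V C}
    (h : ReflTransGen (IntermIn T N) s t) : s.size ≤ t.size := by
  induction h with
  | refl => exact le_rfl
  | tail _ h ih => exact ih.trans h.1.size_lt.le

/-- A term is unifiable with itself, so two different `⊕`-terms cannot share it as an interm. This
makes `IntermIn` a forest. -/
theorem IntermIn.parent_unique (hT : DnutSatisfying T) {a P P' : Term V C}
    (h : IntermIn T N a P) (h' : IntermIn T N a P') : P = P' := by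
  by_contra hne
  exact hT.between P h.2.1 P' h'.2.1 hne a a h.1 h'.1
    (unifiable_of_subst_eq _ (τ := Term.var) rfl)

theorem IntermIn.eq_of_eval_eq (hT : DnutSatisfying T) (hI : IntermsReflect T N ρ)
    {a P a' P' : Term V C} (h : IntermIn T N a P) (h' : IntermIn T N a' P')
    (he : a.eval ρ = a'.eval ρ) : a = a' := by
  have hu := hI a P a' P' h h' he
  obtain rfl : P = P' := by
    by_contra hne
    exact hT.between P h.2.1 P' h'.2.1 hne a a' h.1 h'.1 hu
  obtain ⟨⟨n, args, i, rfl, rfl⟩, hP, -⟩ := h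
  obtain ⟨⟨n', args', j, e, rfl⟩, -, -⟩ := h'
  cases e
  by_contra hne
  exact hT.within n args hP i j (fun hij => hne (by rw [hij])) hu

/-- Every atom of the value of an interm is the value of an interm below it. -/
theorem IntermIn.exists_leaf (hT : DnutSatisfying T)
    (hvar : ∀ t ∈ SubTerms T, ∀ x : V, ¬ Interm (.var x) t) {s P : Term V C}
    (h : IntermIn T N s P) {a : Term V C} (ha : a ∈ (s.eval ρ).support) :
    ∃ l Q, ReflTransGen (IntermIn T N) l s ∧ IntermIn T N l Q ∧
      l.eval ρ = Finsupp.single a 1 := by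
  induction s generalizing P with
  | var x => exact absurd h.1 (hvar P h.2.1 x)
  | zero => exact absurd h.1 (hT.unity P h.2.1)
  | const c =>
    have := Finset.mem_singleton.1 (Finsupp.support_single_subset ha)
    exact ⟨_, P, .refl, h, by rw [this]; rfl⟩
  | std f args =>
    have := Finset.mem_singleton.1 (Finsupp.support_single_subset ha)
    exact ⟨_, P, .refl, h, by rw [this]; rfl⟩
  | oplus n args ih =>
    obtain ⟨i, hi⟩ := Term.mem_support_eval_oplus ha
    have hs : Term.oplus n args ∈ SubTerms T := by
      obtain ⟨⟨m, b, j, rfl, e⟩, hP, -⟩ := h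
      exact e ▸ SubTerms.oplus_arg hP j
    have hi' := IntermIn.arg hs (h.1.size_lt.le.trans h.2.2) i
    obtain ⟨l, Q, hl, hQ, e⟩ := ih i hi' hi
    exact ⟨l, Q, hl.tail hi', hQ, e⟩

/-- A common atom is the value of a single leaf below both interms, and the ancestors of a node in a
forest form a chain. -/
theorem IntermIn.total_of_mem_support (hT : DnutSatisfying T)
    (hvar : ∀ t ∈ SubTerms T, ∀ x : V, ¬ Interm (.var x) t) (hI : IntermsReflect T N ρ)
    {s P s' P' : Term V C} (h : IntermIn T N s P) (h' : IntermIn T N s' P') {a : Term V C}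
    (ha : a ∈ (s.eval ρ).support) (ha' : a ∈ (s'.eval ρ).support) :
    ReflTransGen (IntermIn T N) s s' ∨ ReflTransGen (IntermIn T N) s' s := by
  obtain ⟨l, Q, hl, hQ, e⟩ := h.exists_leaf hT hvar ha
  obtain ⟨l', Q', hl', hQ', e'⟩ := h'.exists_leaf hT hvar ha'
  obtain rfl := hQ.eq_of_eval_eq hT hI hQ' (e.trans e'.symm)
  exact ReflTransGen.total_of_right_unique
    (fun _ _ _ h1 h2 => IntermIn.parent_unique hT h1 h2) hl hl'

theorem disjoint_support_interms (hT : DnutSatisfying T)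
    (hvar : ∀ t ∈ SubTerms T, ∀ x : V, ¬ Interm (.var x) t) (hI : IntermsReflect T N ρ)
    {n : ℕ} {args : Fin (n + 2) → Term V C} (h : Term.oplus n args ∈ SubTerms T)
    (hN : (Term.oplus n args).size ≤ N) {i j : Fin (n + 2)} (hij : i ≠ j) {a : Term V C}
    (ha : a ∈ ((args i).eval ρ).support) : a ∉ ((args j).eval ρ).support := by
  -- A nontrivial upward path from one interm passes through the common parent, which is larger than
  -- the other interm.
  have key : ∀ i j, i ≠ j → ¬ ReflTransGen (IntermIn T N) (args i) (args j) := by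
    intro i j hij hr
    rcases hr.cases_head with e | ⟨P, hP, hr⟩
    · exact hT.within n args h i j hij (unifiable_of_subst_eq _ (τ := Term.var) (by rw [e]))
    · obtain rfl := IntermIn.parent_unique hT hP (IntermIn.arg h hN i)
      exact absurd (IntermIn.size_le_of_reflTransGen hr) (Term.size_lt_oplus n args j).not_ge
  intro ha'
  rcases IntermIn.total_of_mem_support hT hvar hI (IntermIn.arg h hN i) (IntermIn.arg h hN j)
    ha ha' with hr | hr
  · exact key i j hij hr
  · exact key j i hij.symm hr

/-- By disjointness, an atom of one interm has coefficient zero in all the others and survives in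
the sum. -/
theorem support_interm_subset (hT : DnutSatisfying T)
    (hvar : ∀ t ∈ SubTerms T, ∀ x : V, ¬ Interm (.var x) t) (hI : IntermsReflect T N ρ)
    {n : ℕ} {args : Fin (n + 2) → Term V C} (h : Term.oplus n args ∈ SubTerms T)
    (hN : (Term.oplus n args).size ≤ N) (i : Fin (n + 2)) :
    ((args i).eval ρ).support ⊆ ((Term.oplus n args).eval ρ).support := by
  intro a ha
  rw [Finsupp.mem_support_iff, Term.eval, Finsupp.finsetSum_apply,
    Finset.sum_eq_single i (fun j _ hj => Finsupp.notMem_support_iff.1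
      (disjoint_support_interms hT hvar hI h hN hj.symm ha))
      (fun hi => absurd (Finset.mem_univ i) hi)]
  exact Finsupp.mem_support_iff.1 ha

theorem IntermIn.support_nonempty (hT : DnutSatisfying T)
    (hvar : ∀ t ∈ SubTerms T, ∀ x : V, ¬ Interm (.var x) t) (hI : IntermsReflect T N ρ)
    {s P : Term V C} (h : IntermIn T N s P) : (s.eval ρ).support.Nonempty := by
  induction s generalizing P with
  | var x => exact absurd h.1 (hvar P h.2.1 x)
  | zero => exact absurd h.1 (hT.unity P h.2.1)
  | const c => simp [Term.eval]
  | std f args => simp [Term.eval]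
  | oplus n args ih =>
    have hs : Term.oplus n args ∈ SubTerms T := by
      obtain ⟨⟨m, b, j, rfl, e⟩, hP, -⟩ := h
      exact e ▸ SubTerms.oplus_arg hP j
    have hN := h.1.size_lt.le.trans h.2.2
    exact (ih 0 (IntermIn.arg hs hN 0)).mono (support_interm_subset hT hvar hI hs hN 0)

theorem support_interm_ssubset (hT : DnutSatisfying T)
    (hvar : ∀ t ∈ SubTerms T, ∀ x : V, ¬ Interm (.var x) t) (hI : IntermsReflect T N ρ)
    {n : ℕ} {args : Fin (n + 2) → Term V C} (h : Term.oplus n args ∈ SubTerms T)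
    (hN : (Term.oplus n args).size ≤ N) (i : Fin (n + 2)) :
    ((args i).eval ρ).support ⊂ ((Term.oplus n args).eval ρ).support := by
  refine ⟨support_interm_subset hT hvar hI h hN i, fun hsub => ?_⟩
  obtain ⟨j, hj⟩ := exists_ne i
  obtain ⟨a, ha⟩ := (IntermIn.arg h hN j).support_nonempty hT hvar hI
  exact disjoint_support_interms hT hvar hI h hN hj ha
    (hsub (support_interm_subset hT hvar hI h hN j ha))

/-- Separates the values of `⊕`-terms from those of the other non-variable terms, which have at most
one atom. -/
theorem oplus_support_not_subset_singleton (hT : DnutSatisfying T)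
    (hvar : ∀ t ∈ SubTerms T, ∀ x : V, ¬ Interm (.var x) t) (hI : IntermsReflect T N ρ)
    {n : ℕ} {args : Fin (n + 2) → Term V C} (h : Term.oplus n args ∈ SubTerms T)
    (hN : (Term.oplus n args).size ≤ N) (b : Term V C) :
    ¬ ((Term.oplus n args).eval ρ).support ⊆ {b} := by
  intro hb
  obtain ⟨a, ha⟩ := (IntermIn.arg h hN 0).support_nonempty hT hvar hI
  have h0 := (support_interm_ssubset hT hvar hI h hN 0).trans_subset hb
  rw [Finset.ssubset_singleton_iff] at h0
  simp [h0] at ha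

theorem IntermIn.support_ssubset_of_transGen (hT : DnutSatisfying T)
    (hvar : ∀ t ∈ SubTerms T, ∀ x : V, ¬ Interm (.var x) t) (hI : IntermsReflect T N ρ)
    {s t : Term V C} (h : TransGen (IntermIn T N) s t) :
    (s.eval ρ).support ⊂ (t.eval ρ).support := by
  have step : ∀ {a P}, IntermIn T N a P → (a.eval ρ).support ⊂ (P.eval ρ).support := by
    rintro _ _ ⟨⟨n, args, i, rfl, rfl⟩, hP, hN⟩
    exact support_interm_ssubset hT hvar hI hP hN i
  induction h with
  | single h => exact step h
  | tail _ h ih => exact ih.trans (step h)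

/-- Different `⊕`-terms have different values. -/
theorem oplus_eq_of_eval_eq (hT : DnutSatisfying T)
    (hvar : ∀ t ∈ SubTerms T, ∀ x : V, ¬ Interm (.var x) t) (hI : IntermsReflect T N ρ)
    {n n' : ℕ} {args : Fin (n + 2) → Term V C} {args' : Fin (n' + 2) → Term V C}
    (h : Term.oplus n args ∈ SubTerms T) (hN : (Term.oplus n args).size ≤ N)
    (h' : Term.oplus n' args' ∈ SubTerms T) (hN' : (Term.oplus n' args').size ≤ N)
    (he : (Term.oplus n args).eval ρ = (Term.oplus n' args').eval ρ) :
    Term.oplus n args = Term.oplus n' args' := by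
  obtain ⟨a, ha⟩ := (IntermIn.arg h hN 0).support_nonempty hT hvar hI
  have ha' := support_interm_subset hT hvar hI h hN 0 ha
  rw [he] at ha'
  obtain ⟨j, hj⟩ := Term.mem_support_eval_oplus ha'
  obtain ⟨l, Q, hl, hQ, e⟩ := (IntermIn.arg h hN 0).exists_leaf hT hvar ha
  obtain ⟨l', Q', hl', hQ', e'⟩ := (IntermIn.arg h' hN' j).exists_leaf hT hvar hj
  obtain rfl := hQ.eq_of_eval_eq hT hI hQ' (e.trans e'.symm)
  -- Both `⊕`-terms lie above the same leaf, hence are comparable; a strict relation would make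
  -- their supports differ.
  rcases ReflTransGen.total_of_right_unique (r := IntermIn T N)
    (fun _ _ _ h1 h2 => IntermIn.parent_unique hT h1 h2)
    (hl.tail (IntermIn.arg h hN 0)) (hl'.tail (IntermIn.arg h' hN' j)) with hr | hr
  · rcases reflTransGen_iff_eq_or_transGen.1 hr with e | ht
    · exact e.symm
    · exact absurd (by rw [he]) (IntermIn.support_ssubset_of_transGen hT hvar hI ht).ne
  · rcases reflTransGen_iff_eq_or_transGen.1 hr with e | ht
    · exact e
    · exact absurd (by rw [he]) (IntermIn.support_ssubset_of_transGen hT hvar hI ht).ne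

/-- The values of two terms that are not variables determine their heads and the values of
their arguments. -/
theorem mapArgs_eq_of_eval_eq (hT : DnutSatisfying T)
    (hvar : ∀ t ∈ SubTerms T, ∀ x : V, ¬ Interm (.var x) t) (hI : IntermsReflect T N ρ)
    {s t : Term V C} (hs : s ∈ SubTerms T) (hsN : s.size ≤ N) (ht : t ∈ SubTerms T)
    (htN : t.size ≤ N) (hsx : ∀ x, s ≠ .var x) (htx : ∀ x, t ≠ .var x)
    (he : s.eval ρ = t.eval ρ) (g : Value V C → Term V C) :
    s.mapArgs (fun a => g (a.eval ρ)) = t.mapArgs fun a => g (a.eval ρ) := by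
  have small : ∀ u : Term V C, (∀ x, u ≠ .var x) → (∀ n args, u ≠ .oplus n args) →
      ∃ b, (u.eval ρ).support ⊆ {b} := by
    intro u hux huo
    cases u with
    | var x => exact absurd rfl (hux x)
    | zero => exact ⟨.zero, by simp [Term.eval]⟩
    | const c => exact ⟨_, Finsupp.support_single_subset⟩
    | std f args => exact ⟨_, Finsupp.support_single_subset⟩
    | oplus n args => exact absurd rfl (huo n args)
  by_cases hso : ∃ n args, s = .oplus n args
  · obtain ⟨n, args, rfl⟩ := hso
    by_cases hto : ∃ n args, t = .oplus n args
    · obtain ⟨n', args', rfl⟩ := hto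
      rw [oplus_eq_of_eval_eq hT hvar hI hs hsN ht htN he]
    · obtain ⟨b, hb⟩ := small t htx fun n args e => hto ⟨n, args, e⟩
      exact absurd (he ▸ hb) (oplus_support_not_subset_singleton hT hvar hI hs hsN b)
  · by_cases hto : ∃ n args, t = .oplus n args
    · obtain ⟨n', args', rfl⟩ := hto
      obtain ⟨b, hb⟩ := small s hsx fun n args e => hso ⟨n, args, e⟩
      exact absurd (he ▸ hb) (oplus_support_not_subset_singleton hT hvar hI ht htN b)
    · have inj : ∀ a b : Term V C, Finsupp.single a (1 : ZMod 2) = Finsupp.single b 1 → a = b :=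
        fun a b h => Finsupp.single_left_injective one_ne_zero h
      cases s with
      | var x => exact absurd rfl (hsx x)
      | oplus n args => exact absurd ⟨n, args, rfl⟩ hso
      | zero =>
        cases t with
        | var x => exact absurd rfl (htx x)
        | oplus n args => exact absurd ⟨n, args, rfl⟩ hto
        | zero => rfl
        | const | std => exact absurd he.symm (Finsupp.single_ne_zero.2 one_ne_zero)
      | const c =>
        cases t with
        | var x => exact absurd rfl (htx x)
        | oplus n args => exact absurd ⟨n, args, rfl⟩ hto
        | zero => exact absurd he (Finsupp.single_ne_zero.2 one_ne_zero)
        | std => cases inj _ _ he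
        | const => cases inj _ _ he; rfl
      | std f args =>
        cases t with
        | var x => exact absurd rfl (htx x)
        | oplus n args => exact absurd ⟨n, args, rfl⟩ hto
        | zero => exact absurd he (Finsupp.single_ne_zero.2 one_ne_zero)
        | const => cases inj _ _ he
        | std f' args' =>
          obtain ⟨rfl, h2⟩ := Term.std.inj (inj _ _ he)
          have h3 : ∀ i, (args i).eval ρ = (args' i).eval ρ := fun i =>
            Value.code_injective (congrFun (eq_of_heq h2) i)
          simp only [Term.mapArgs, h3]

theorem exists_subst_eq_of_intermsReflect (hT : DnutSatisfying T)
    (hvar : ∀ t ∈ SubTerms T, ∀ x : V, ¬ Interm (.var x) t) (hI : IntermsReflect T N ρ) :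
    ∃ τ : V → Term V C, ∀ s ∈ SubTerms T, s.size ≤ N → ∀ t ∈ SubTerms T, t.size ≤ N →
      s.eval ρ = t.eval ρ → s.subst τ = t.subst τ := by
  obtain ⟨τ, hτ⟩ := exists_subst_eq_of_value {s | s ∈ SubTerms T ∧ s.size ≤ N}
    (Term.eval ρ) (fun w => w.code.size)
    (fun f args h i => ⟨⟨SubTerms.std_arg h.1 i, (Term.size_lt_std f args i).le.trans h.2⟩, by
      -- The value of a standard term is a single atom, which contains the codes of the argument
      -- values.
      rw [Value.size_code (Term.eval ρ (.std f args)), Term.eval,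
        Finsupp.support_single _ one_ne_zero, Finset.sum_singleton]
      exact (Term.size_lt_std f (fun i => ((args i).eval ρ).code) i).trans (Nat.lt_succ_self _)⟩)
    (fun n args h i => ⟨⟨SubTerms.oplus_arg h.1 i, (Term.size_lt_oplus n args i).le.trans h.2⟩,
      Value.size_code_lt (support_interm_ssubset hT hvar hI h.1 h.2 i)⟩)
    (fun s hs t ht hsx htx he g =>
      mapArgs_eq_of_eval_eq hT hvar hI hs.1 hs.2 ht.1 ht.2 hsx htx he g)
  exact ⟨τ, fun s hs hsN t ht htN he => hτ s ⟨hs, hsN⟩ t ⟨ht, htN⟩ he⟩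

theorem intermsReflect (hT : DnutSatisfying T)
    (hvar : ∀ t ∈ SubTerms T, ∀ x : V, ¬ Interm (.var x) t) (N : ℕ) (ρ : V → Value V C) :
    IntermsReflect T N ρ := by
  induction N with
  | zero => exact fun _ P _ _ h _ _ => absurd h.2.2 P.size_pos.not_ge
  | succ N ih =>
    -- The bound `N` is enough: interms of an `⊕`-term of size at most `N + 1` have size at most
    -- `N`.
    obtain ⟨τ, hτ⟩ := exists_subst_eq_of_intermsReflect hT hvar ih
    have mem : ∀ {a P}, IntermIn T (N + 1) a P → a ∈ SubTerms T ∧ a.size ≤ N := by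
      rintro _ _ ⟨⟨n, args, i, rfl, rfl⟩, hP, hN⟩
      exact ⟨SubTerms.oplus_arg hP i,
        Nat.le_of_lt_succ ((Term.size_lt_oplus n args i).trans_le hN)⟩
    intro a P a' P' h h' he
    exact unifiable_of_subst_eq _ (hτ a (mem h).1 (mem h).2 a' (mem h').1 (mem h').2 he)

end Tagging

end TagUnif

theorem theorem1 {V : Type*} {C : Type*} (T : Set (TagUnif.Term V C))
    (hT : TagUnif.DnutSatisfying T)
    (hvar : ∀ t ∈ TagUnif.SubTerms T, ∀ x : V, ¬ TagUnif.Interm (.var x) t)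
    (m t : TagUnif.Term V C) (hm : m ∈ T) (ht : t ∈ T)
    (hm' : ∀ x : V, m ≠ .var x) (ht' : ∀ x : V, t ≠ .var x)
    (h : TagUnif.Unifiable (TagUnif.stdTheory V C ∪ TagUnif.acun V C) m t) :
    TagUnif.Unifiable (TagUnif.stdTheory V C ∪ TagUnif.freeTheory V C) m t := by
  obtain ⟨σ, hσ⟩ := h
  -- The zero assignment is an arbitrary choice; passing through `σ`, it becomes the assignment of
  -- the value of `σ x` to each `x`.
  have he := TagUnif.EqMod.eval_eq (hσ (m, t) rfl) fun _ => 0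
  rw [TagUnif.Term.eval_subst, TagUnif.Term.eval_subst] at he
  obtain ⟨τ, hτ⟩ := TagUnif.exists_subst_eq_of_intermsReflect hT hvar
    (TagUnif.intermsReflect hT hvar (max m.size t.size) _)
  exact TagUnif.unifiable_of_subst_eq _
    (hτ m ⟨m, hm, .refl m⟩ (le_max_left _ _) t ⟨t, ht, .refl t⟩ (le_max_right _ _) he)
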